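/- Let $G$ be a finite simple graph that contains a cycle. Let $\mathrm{tw}(G)$ denote its tree-width, and let $\ell(G)$ be the smallest natural number $\ell$ such that the cycles of length at most $\ell$ in $G$ generate the cycle space of $G$ (over $\mathbb{F}_2$). A \emph{bramble} of $G$ is a collection of connected (in particular nonempty) vertex sets of $G$ such that the union of any two of them is again connected; its \emph{connected order} is the minimum size of a connected vertex set of $G$ that meets every element of the bramble. Then the connected order of every bramble of $G$ is at most $$\mathrm{tw}(G)\left\lfloor \frac{\ell(G)}{2} \right\rfloor + 1 .$$ In other words, every bramble of $G$ can be covered by a connected vertex set of size at most $\mathrm{tw}(G)\lfloor \ell(G)/2\rfloor + 1$. -/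

import Mathlib

namespace SimpleGraph

universe u v

variable {V : Type u}

/-- A tree-decomposition of `G` with node set `T`: a tree on `T` and a family of parts. -/
structure TreeDecomposition (G : SimpleGraph V) (T : Type v) where
  /-- the decomposition tree -/
  tree : SimpleGraph T
  isTree : tree.IsTree
  /-- the parts -/
  part : T → Set V
  /-- every vertex lies in some part -/
  exists_mem_part : ∀ x : V, ∃ t, x ∈ part t
  /-- both ends of every edge lie in a common part -/
  exists_adj_mem_part : ∀ x y : V, G.Adj x y → ∃ t, x ∈ part t ∧ y ∈ part t
  /-- a part on the path between two nodes contains the intersection of their parts -/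
  inter_subset_part : ∀ (t₁ t₂ t₃ : T) (p : tree.Walk t₁ t₃), p.IsPath → t₂ ∈ p.support →
    part t₁ ∩ part t₃ ⊆ part t₂

/-- The width `max_t (|V_t| - 1)` of a tree-decomposition. It is used only for finite nonempty
graphs and finite trees, where some part is nonempty, so that truncated subtraction does not
change the maximum. -/
noncomputable def TreeDecomposition.width {G : SimpleGraph V} {T : Type v}
    (D : G.TreeDecomposition T) : ℕ :=
  ⨆ t, ((D.part t).ncard - 1)

/-- The tree-width of a finite graph: the minimum width of its tree-decompositions (over finite
trees, as all graphs are finite). -/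
noncomputable def treeWidth (G : SimpleGraph V) : ℕ :=
  sInf {k : ℕ | ∃ (T : Type) (_ : Finite T) (D : G.TreeDecomposition T), D.width = k}

/-- The element of the edge space (over the field with two elements) that is given by the edge set
of a closed walk (applied to cycles below). -/
noncomputable def edgeVector (G : SimpleGraph V) {x : V} (c : G.Walk x x) :
    G.edgeSet → ZMod 2 :=
  Set.indicator {e : G.edgeSet | (e : Sym2 V) ∈ c.edges} 1

/-- The cycle space: the subspace of the edge space that is spanned by all cycles. -/
noncomputable def cycleSpace (G : SimpleGraph V) : Submodule (ZMod 2) (G.edgeSet → ZMod 2) :=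
  Submodule.span (ZMod 2)
    {z | ∃ (x : V) (c : G.Walk x x), c.IsCycle ∧ z = G.edgeVector c}

/-- The subspace of the edge space that is spanned by the cycles of length at most `l`. -/
noncomputable def shortCycleSpan (G : SimpleGraph V) (l : ℕ) :
    Submodule (ZMod 2) (G.edgeSet → ZMod 2) :=
  Submodule.span (ZMod 2)
    {z | ∃ (x : V) (c : G.Walk x x), c.IsCycle ∧ c.length ≤ l ∧ z = G.edgeVector c}

/-- `ℓ(G)`: the smallest natural number `l` such that the cycles of length at most `l` generate
the cycle space of `G`. -/
noncomputable def cycleGenLength (G : SimpleGraph V) : ℕ :=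
  sInf {l : ℕ | G.shortCycleSpan l = G.cycleSpace}

/-- A vertex set is connected if it is nonempty and induces a connected subgraph. -/
def IsConnectedSet (G : SimpleGraph V) (X : Set V) : Prop :=
  (G.induce X).Connected

/-- A bramble: a collection of connected vertex sets, any two of which have a connected union. -/
structure IsBramble (G : SimpleGraph V) (B : Set (Set V)) : Prop where
  connected : ∀ X ∈ B, G.IsConnectedSet X
  connected_union : ∀ X ∈ B, ∀ Y ∈ B, G.IsConnectedSet (X ∪ Y)

/-- `X` covers `B` if it meets every element of `B`. -/
def Covers (X : Set V) (B : Set (Set V)) : Prop :=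
  ∀ Y ∈ B, (X ∩ Y).Nonempty

/-- The connected order of `B`: the minimum size of a connected cover (`⊤` if there is none, or no
finite one). -/
noncomputable def connectedOrder (G : SimpleGraph V) (B : Set (Set V)) : ℕ∞ :=
  ⨅ X ∈ {X : Set V | G.IsConnectedSet X ∧ Covers X B}, X.encard

end SimpleGraph

/-! Let r = ⌊ℓ(G)/2⌋ and let U lie inside a part of a tree-decomposition of minimum width. Group U
into classes linked by walks of length at most r. A class S lies in a connected set of size at most
(|S| - 1)r + 1 (`exists_isConnectedSet_nearComponent_subset`), so it suffices that for some U some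
class covers the bramble.

Otherwise the bramble picks a component of G - S for each class S. Any two of these meet, and no
cycle of length at most ℓ(G) meets the boundaries of two, since it would link their classes. As such
cycles generate the cycle space, a parity argument (`inter_nonempty_of_shortCycleSeparated`) yields
a Helly property: the intersection of all these components is connected. It avoids U and shrinks as
U grows. Such a choice for every U inside a part is impossible (`exists_not_isConnectedSet`): the
parts would point along the tree, two adjacent nodes would point at each other, and the intersection
of their parts could not separate what they point to. -/

namespace SimpleGraph

variable {V : Type*} {G : SimpleGraph V}

/-! ### Edge labellings and the cycle space -/

/-- The sum of an edge labelling along a walk. -/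
def Walk.edgeSum (φ : Sym2 V → ZMod 2) {x y : V} (w : G.Walk x y) : ZMod 2 :=
  (w.edges.map φ).sum

namespace Walk

variable (φ : Sym2 V → ZMod 2) {x y z : V}

@[simp] lemma edgeSum_nil : (nil : G.Walk x x).edgeSum φ = 0 := rfl

@[simp] lemma edgeSum_cons (h : G.Adj x y) (w : G.Walk y z) :
    (cons h w).edgeSum φ = φ s(x, y) + w.edgeSum φ := by
  simp [edgeSum]

@[simp] lemma edgeSum_append (w : G.Walk x y) (w' : G.Walk y z) :
    (w.append w').edgeSum φ = w.edgeSum φ + w'.edgeSum φ := by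
  simp [edgeSum]

lemma edgeSum_eq_zero {φ : Sym2 V → ZMod 2} {w : G.Walk x y} (h : ∀ e ∈ w.edges, φ e = 0) :
    w.edgeSum φ = 0 :=
  List.sum_eq_zero (by simpa using h)

/-- A labelling which agrees along a walk with the coboundary of `f` telescopes. -/
lemma edgeSum_eq_of_coboundary {φ : Sym2 V → ZMod 2} {f : V → ZMod 2} (w : G.Walk x y)
    (h : ∀ a b, s(a, b) ∈ w.edges → φ s(a, b) = f a + f b) : w.edgeSum φ = f x + f y := by
  induction w with
  | nil => simp [CharTwo.add_self_eq_zero]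
  | @cons a b c hab w ih =>
    rw [edgeSum_cons, ih fun a b hm ↦ h a b (by simp [hm]), h a b (by simp)]
    linear_combination CharTwo.add_self_eq_zero (f b)

lemma IsPath.edges_eq_of_mem {w : G.Walk x y} (hw : w.IsPath) (he : s(y, x) ∈ w.edges) :
    w.edges = [s(y, x)] := by
  cases w with
  | nil => simp at he
  | @cons _ v _ h w =>
    rw [cons_isPath_iff] at hw
    rw [edges_cons, List.mem_cons] at he
    rcases he with he | he
    · have hv : v = y := by
        rcases Sym2.eq_iff.1 he with ⟨h1, h2⟩ | ⟨h1, -⟩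
        · rw [← h2, h1]
        · exact h1.symm
      subst hv
      have := (isPath_iff_nil.1 hw.1).eq_nil
      subst this
      simp [Sym2.eq_swap]
    · exact absurd (w.snd_mem_support_of_mem_edges he) hw.2

lemma edgeSum_bypass [DecidableEq V] {φ : Sym2 V → ZMod 2}
    (hφ : ∀ (x : V) (c : G.Walk x x), c.IsCycle → c.edgeSum φ = 0) (w : G.Walk x y) :
    w.bypass.edgeSum φ = w.edgeSum φ := by
  induction w with
  | nil => rfl
  | @cons a b c h w ih =>
    rw [edgeSum_cons, ← ih, bypass]
    by_cases hs : a ∈ w.bypass.support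
    · simp only [hs, dif_pos]
      -- The closed walk cut out is either one edge traversed back and forth or a cycle.
      have hsum : φ s(a, b) + (w.bypass.takeUntil a hs).edgeSum φ = 0 := by
        have hp := w.bypass_isPath.takeUntil hs
        by_cases he : s(a, b) ∈ (w.bypass.takeUntil a hs).edges
        · rw [edgeSum, hp.edges_eq_of_mem he]
          simp [CharTwo.add_self_eq_zero]
        · simpa using hφ a (cons h _) ((cons_isCycle_iff _ h).2 ⟨hp, he⟩)
      conv_rhs => rw [← take_spec w.bypass hs, edgeSum_append, ← add_assoc, hsum, zero_add]
    · simp [hs]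

lemma edgeSum_eq_zero_of_forall_isCycle {φ : Sym2 V → ZMod 2}
    (hφ : ∀ (x : V) (c : G.Walk x x), c.IsCycle → c.edgeSum φ = 0) (w : G.Walk x x) :
    w.edgeSum φ = 0 := by
  classical
  rw [← edgeSum_bypass hφ, (isPath_iff_nil.1 w.bypass_isPath).eq_nil, edgeSum_nil]

end Walk

/-- Labellings that sum to zero along short cycles do so along all closed walks, provided the short
cycles generate the cycle space. -/
lemma edgeSum_eq_zero_of_short [Finite V] {l : ℕ} (hl : G.shortCycleSpan l = G.cycleSpace)
    {φ : Sym2 V → ZMod 2}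
    (hφ : ∀ (x : V) (c : G.Walk x x), c.IsCycle → c.length ≤ l → c.edgeSum φ = 0)
    {x : V} (w : G.Walk x x) : w.edgeSum φ = 0 := by
  classical
  have := Fintype.ofFinite V
  -- As a linear functional on the edge space, the labelling vanishes on the span of the short
  -- cycles once it vanishes on each of them.
  let Φ : (G.edgeSet → ZMod 2) →ₗ[ZMod 2] ZMod 2 :=
    ∑ e : G.edgeSet, φ e • LinearMap.proj e
  have hΦ : ∀ (x : V) (c : G.Walk x x), c.IsCycle → Φ (G.edgeVector c) = c.edgeSum φ := by
    intro x c hc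
    have h1 : Φ (G.edgeVector c) =
        ∑ e : G.edgeSet, if (e : Sym2 V) ∈ c.edges.toFinset then φ e else 0 := by
      simp [Φ, edgeVector, Set.indicator_apply]
    have h2 : ∑ e : G.edgeSet, (if (e : Sym2 V) ∈ c.edges.toFinset then φ e else 0) =
        ∑ e ∈ G.edgeFinset, if e ∈ c.edges.toFinset then φ e else 0 :=
      (Finset.sum_subtype G.edgeFinset (fun e ↦ mem_edgeFinset)
        (fun e ↦ if e ∈ c.edges.toFinset then φ e else 0)).symm
    rw [h1, h2, Finset.sum_ite_mem, Finset.inter_eq_right.2, List.sum_toFinset _ hc.edges_nodup,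
      Walk.edgeSum]
    intro e he
    exact mem_edgeFinset.2 (c.edges_subset_edgeSet (List.mem_toFinset.1 he))
  have hspan : G.cycleSpace ≤ LinearMap.ker Φ := by
    rw [← hl, shortCycleSpan, Submodule.span_le]
    rintro _ ⟨x, c, hc, hcl, rfl⟩
    simp [hΦ x c hc, hφ x c hc hcl]
  refine Walk.edgeSum_eq_zero_of_forall_isCycle (fun y c hc ↦ ?_) w
  rw [← hΦ y c hc]
  exact hspan (Submodule.subset_span ⟨y, c, hc, rfl⟩)

/-- The infimum is attained, because no cycle is longer than `Nat.card V`. -/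
lemma cycleGenLength_spec [Finite V] (G : SimpleGraph V) :
    G.shortCycleSpan G.cycleGenLength = G.cycleSpace := by
  refine Nat.sInf_mem (s := {l : ℕ | G.shortCycleSpan l = G.cycleSpace}) ⟨Nat.card V, ?_⟩
  refine le_antisymm (Submodule.span_mono ?_) (Submodule.span_mono ?_)
  · rintro _ ⟨x, c, hc, -, rfl⟩
    exact ⟨x, c, hc, rfl⟩
  · rintro _ ⟨x, c, hc, rfl⟩
    refine ⟨x, c, hc, ?_, rfl⟩
    have := Fintype.ofFinite V
    have h := hc.support_nodup.length_le_card
    rw [List.length_tail, Walk.length_support] at h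
    simpa [Nat.card_eq_fintype_card] using h

/-- With no cycles of length at most 2, a smaller value would make every labelling vanish on closed
walks, but the indicator of one edge of a cycle sums to 1 along it. -/
lemma three_le_cycleGenLength [Finite V] (hG : ∃ (x : V) (c : G.Walk x x), c.IsCycle) :
    3 ≤ G.cycleGenLength := by
  classical
  obtain ⟨x, c, hc⟩ := hG
  by_contra! hlt
  cases c with
  | nil => simp at hc
  | @cons _ y _ h p =>
    have h0 := edgeSum_eq_zero_of_short G.cycleGenLength_spec (φ := Pi.single s(x, y) 1)
      (fun z d hd hdl ↦ absurd hd.three_le_length (by omega)) (Walk.cons h p)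
    have hp : p.edgeSum (Pi.single s(x, y) 1) = 0 := by
      refine Walk.edgeSum_eq_zero fun e he ↦ Pi.single_eq_of_ne ?_ 1
      rintro rfl
      exact ((Walk.cons_isCycle_iff p h).1 hc).2 he
    simp [hp] at h0

/-! ### Intersections of connected sets -/

lemma isConnectedSet_iff {X : Set V} :
    G.IsConnectedSet X ↔
      X.Nonempty ∧ ∀ x ∈ X, ∀ y ∈ X, ∃ w : G.Walk x y, ∀ z ∈ w.support, z ∈ X := by
  constructor
  · intro h
    refine ⟨Set.nonempty_coe_sort.1 h.nonempty, fun x hx y hy ↦ ?_⟩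
    obtain ⟨w⟩ := h.preconnected ⟨x, hx⟩ ⟨y, hy⟩
    refine ⟨w.map (Embedding.induce X).toHom, fun z hz ↦ ?_⟩
    have hz' : z ∈ w.support.map (Embedding.induce (G := G) X).toHom := by
      rwa [← Walk.support_map]
    obtain ⟨a, -, rfl⟩ := List.mem_map.1 hz'
    exact a.2
  · rintro ⟨hne, h⟩
    have := hne.to_subtype
    refine ⟨fun x y ↦ ?_⟩
    obtain ⟨w, hw⟩ := h x x.2 y y.2
    exact ⟨w.induce X hw⟩

lemma isConnectedSet_singleton (x : V) : G.IsConnectedSet {x} :=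
  isConnectedSet_iff.2 ⟨⟨x, rfl⟩, by rintro _ rfl _ rfl; exact ⟨.nil, by simp⟩⟩

/-- The vertices outside `A` with a neighbour in `A`. -/
def outerBoundary (G : SimpleGraph V) (A : Set V) : Set V :=
  {y | y ∉ A ∧ ∃ x ∈ A, G.Adj x y}

lemma Walk.mem_iff_of_outerBoundary {A : Set V} {x y : V} (w : G.Walk x y)
    (h : ∀ z ∈ w.support, z ∉ G.outerBoundary A) : ∀ z ∈ w.support, (z ∈ A ↔ x ∈ A) := by
  induction w with
  | nil => simp
  | @cons a b c hab w ih =>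
    have h1 : b ∈ A ↔ a ∈ A := by
      have ha := h a (by simp)
      have hb := h b (by simp)
      constructor <;> intro hm <;> by_contra hn
      · exact ha ⟨hn, b, hm, hab.symm⟩
      · exact hb ⟨hn, a, hm, hab⟩
    intro z hz
    rw [support_cons, List.mem_cons] at hz
    rcases hz with rfl | hz
    · rfl
    · rw [ih (fun z hz ↦ h z (by simp [hz])) z hz, h1]

/-- No cycle of length at most `l` meets both `X` and `Y`. -/
def ShortCycleSeparated (G : SimpleGraph V) (l : ℕ) (X Y : Set V) : Prop :=
  ∀ (x : V) (c : G.Walk x x), c.IsCycle → c.length ≤ l →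
    (∀ z ∈ c.support, z ∉ X) ∨ (∀ z ∈ c.support, z ∉ Y)

/-- If no short cycle meets the boundaries of both `A` and `A'`, then `A ∩ A'` is crossed in a
simply connected manner: a connected set that meets `A` and `A'` meets every union of components
of `A ∩ A'`. -/
lemma inter_nonempty_of_shortCycleSeparated [Finite V] {A A' P W : Set V}
    (hA : G.IsConnectedSet A) (hA' : G.IsConnectedSet A')
    (hsep : G.ShortCycleSeparated G.cycleGenLength (G.outerBoundary A) (G.outerBoundary A'))
    (hPA : P ⊆ A) (hPA' : P ⊆ A') (hP : P.Nonempty)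
    (hPc : ∀ x ∈ P, ∀ y ∈ A ∩ A', G.Adj x y → y ∈ P)
    (hW : G.IsConnectedSet W) (hWA : (W ∩ A).Nonempty) (hWA' : (W ∩ A').Nonempty) :
    (W ∩ P).Nonempty := by
  classical
  by_contra hWP
  have hWP' : ∀ z ∈ W, z ∉ P := fun z hz hz' ↦ hWP ⟨z, hz, hz'⟩
  -- Inside `A` these are exactly the edges leaving `P`, so there `φ` is the coboundary of the
  -- indicator of `P`. No such edge lies inside `A'` or avoids `P`.
  let φ : Sym2 V → ZMod 2 := fun e ↦ if ∃ x ∈ P, ∃ y ∈ A \ A', e = s(x, y) then 1 else 0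
  have hφ0 : ∀ a b, (a ∈ P → b ∈ A → b ∈ A') → (b ∈ P → a ∈ A → a ∈ A') →
      φ s(a, b) = 0 := by
    intro a b h1 h2
    refine if_neg ?_
    rintro ⟨x, hx, y, hy, he⟩
    rcases Sym2.eq_iff.1 he with ⟨rfl, rfl⟩ | ⟨rfl, rfl⟩
    · exact hy.2 (h1 hx hy.1)
    · exact hy.2 (h2 hx hy.1)
  have hφ1 : ∀ a b, a ∈ P → b ∈ A → b ∉ A' → φ s(a, b) = 1 :=
    fun a b h1 h2 h3 ↦ if_pos ⟨a, h1, b, ⟨h2, h3⟩, rfl⟩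
  let f : V → ZMod 2 := fun x ↦ if x ∈ P then 1 else 0
  have hcob : ∀ {x y : V} (w : G.Walk x y), (∀ z ∈ w.support, z ∈ A) →
      w.edgeSum φ = f x + f y := by
    intro x y w hw
    refine w.edgeSum_eq_of_coboundary fun a b hab ↦ ?_
    have haA := hw a (w.fst_mem_support_of_mem_edges hab)
    have hbA := hw b (w.snd_mem_support_of_mem_edges hab)
    have hadj : G.Adj a b := w.adj_of_mem_edges hab
    by_cases ha : a ∈ P <;> by_cases hb : b ∈ P
    · rw [hφ0 a b (fun _ _ ↦ hPA' hb) (fun _ _ ↦ hPA' ha)]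
      simp [f, ha, hb, CharTwo.add_self_eq_zero]
    · rw [hφ1 a b ha hbA fun hbA' ↦ hb (hPc a ha b ⟨hbA, hbA'⟩ hadj)]
      simp [f, ha, hb]
    · rw [Sym2.eq_swap, hφ1 b a hb haA fun haA' ↦ ha (hPc b hb a ⟨haA, haA'⟩ hadj.symm)]
      simp [f, ha, hb]
    · rw [hφ0 a b (fun h ↦ absurd h ha) (fun h ↦ absurd h hb)]
      simp [f, ha, hb]
  have hzero : ∀ {x y : V} (w : G.Walk x y), (∀ z ∈ w.support, z ∉ P) ∨
      (∀ z ∈ w.support, z ∈ A') → w.edgeSum φ = 0 := by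
    intro x y w hw
    refine Walk.edgeSum_eq_zero fun e ↦ ?_
    induction e with | _ a b
    intro hab
    have ha := w.fst_mem_support_of_mem_edges hab
    have hb := w.snd_mem_support_of_mem_edges hab
    rcases hw with hw | hw
    · exact hφ0 a b (fun h ↦ absurd h (hw a ha)) (fun h ↦ absurd h (hw b hb))
    · exact hφ0 a b (fun _ _ ↦ hw b hb) (fun _ _ ↦ hw a ha)
  have hclosed : ∀ {x : V} (w : G.Walk x x), w.edgeSum φ = 0 := by
    intro x w
    refine edgeSum_eq_zero_of_short G.cycleGenLength_spec (fun x c hc hcl ↦ ?_) w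
    -- A cycle missing one of the boundaries lies wholly inside or wholly outside the corresponding
    -- set; if outside, it avoids `P`.
    rcases hsep x c hc hcl with h | h
    · have hmem := c.mem_iff_of_outerBoundary h
      by_cases hx : x ∈ A
      · rw [hcob c fun z hz ↦ (hmem z hz).2 hx, CharTwo.add_self_eq_zero]
      · exact hzero c (.inl fun z hz hzP ↦ hx ((hmem z hz).1 (hPA hzP)))
    · have hmem := c.mem_iff_of_outerBoundary h
      by_cases hx : x ∈ A'
      · exact hzero c (.inr fun z hz ↦ (hmem z hz).2 hx)
      · exact hzero c (.inl fun z hz hzP ↦ hx ((hmem z hz).1 (hPA' hzP)))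
  obtain ⟨p, hp⟩ := hP
  obtain ⟨a, haW, haA⟩ := hWA
  obtain ⟨a', haW', haA'⟩ := hWA'
  obtain ⟨w₁, hw₁⟩ := (isConnectedSet_iff.1 hA).2 p (hPA hp) a haA
  obtain ⟨w₂, hw₂⟩ := (isConnectedSet_iff.1 hW).2 a haW a' haW'
  obtain ⟨w₃, hw₃⟩ := (isConnectedSet_iff.1 hA').2 a' haA' p (hPA' hp)
  -- This closed walk goes through `A`, then `W`, then `A'`. Only the first stretch contributes, and
  -- it leaves `P` for good parity: its sum is 1.
  have h := hclosed (w₁.append (w₂.append w₃))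
  rw [Walk.edgeSum_append, Walk.edgeSum_append, hcob w₁ hw₁,
    hzero w₂ (.inl fun z hz ↦ hWP' z (hw₂ z hz)), hzero w₃ (.inr hw₃)] at h
  simp [f, hp, hWP' a haW] at h

lemma inter_inter_nonempty [Finite V] {A A' W : Set V}
    (hA : G.IsConnectedSet A) (hA' : G.IsConnectedSet A')
    (hsep : G.ShortCycleSeparated G.cycleGenLength (G.outerBoundary A) (G.outerBoundary A'))
    (hAA' : (A ∩ A').Nonempty)
    (hW : G.IsConnectedSet W) (hWA : (W ∩ A).Nonempty) (hWA' : (W ∩ A').Nonempty) :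
    (W ∩ (A ∩ A')).Nonempty :=
  inter_nonempty_of_shortCycleSeparated hA hA' hsep Set.inter_subset_left Set.inter_subset_right
    hAA' (fun _ _ _ hy _ ↦ hy) hW hWA hWA'

/-- The set `{y}` meets both `A` and `A'`, so by the crossing property it meets the component `P` of
`x` in `A ∩ A'`. -/
lemma IsConnectedSet.inter [Finite V] {A A' : Set V}
    (hA : G.IsConnectedSet A) (hA' : G.IsConnectedSet A')
    (hsep : G.ShortCycleSeparated G.cycleGenLength (G.outerBoundary A) (G.outerBoundary A'))
    (hAA' : (A ∩ A').Nonempty) : G.IsConnectedSet (A ∩ A') := by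
  refine isConnectedSet_iff.2 ⟨hAA', fun x hx y hy ↦ ?_⟩
  let P : Set V := {z | ∃ w : G.Walk x z, ∀ u ∈ w.support, u ∈ A ∩ A'}
  have hPs : P ⊆ A ∩ A' := fun z ⟨w, hw⟩ ↦ hw z w.end_mem_support
  obtain ⟨z, rfl, hz⟩ : (({y} : Set V) ∩ P).Nonempty := by
    refine inter_nonempty_of_shortCycleSeparated (P := P) (W := {y}) hA hA' hsep
      (hPs.trans Set.inter_subset_left) (hPs.trans Set.inter_subset_right)
      ⟨x, .nil, by simpa using hx⟩ ?_ (isConnectedSet_singleton y) ⟨y, rfl, hy.1⟩ ⟨y, rfl, hy.2⟩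
    rintro z ⟨w, hw⟩ u hu hadj
    refine ⟨w.concat hadj, fun v hv ↦ ?_⟩
    rw [Walk.support_concat, List.mem_append, List.mem_singleton] at hv
    rcases hv with hv | rfl
    exacts [hw v hv, hu]
  exact hz

lemma outerBoundary_biInter_subset {ι : Type*} (I : Set ι) (C : ι → Set V) :
    G.outerBoundary (⋂ i ∈ I, C i) ⊆ ⋃ i ∈ I, G.outerBoundary (C i) := by
  rintro y ⟨hy, x, hx, hadj⟩
  simp only [Set.mem_iInter, not_forall] at hy hx
  obtain ⟨i, hi, hyi⟩ := hy
  exact Set.mem_biUnion hi ⟨hyi, x, hx i hi, hadj⟩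

/-- A Helly property: finitely many pairwise intersecting connected sets have a connected
intersection if no short cycle meets the boundary of one of them and the boundaries of others. -/
lemma isConnectedSet_biInter [Finite V] {ι : Type*} (I : Finset ι) (hI : I.Nonempty)
    (C : ι → Set V) (hC : ∀ i ∈ I, G.IsConnectedSet (C i))
    (hCC : ∀ i ∈ I, ∀ j ∈ I, (C i ∩ C j).Nonempty)
    (hsep : ∀ J ⊆ I, ∀ j ∈ I, j ∉ J → G.ShortCycleSeparated G.cycleGenLength
      (⋃ i ∈ J, G.outerBoundary (C i)) (G.outerBoundary (C j))) :
    G.IsConnectedSet (⋂ i ∈ I, C i) ∧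
      ∀ W, G.IsConnectedSet W → (∀ i ∈ I, (W ∩ C i).Nonempty) →
        (W ∩ ⋂ i ∈ I, C i).Nonempty := by
  classical
  induction hI using Finset.Nonempty.cons_induction with
  | singleton i =>
    simp only [Finset.mem_singleton, forall_eq, Set.iInter_iInter_eq_left] at *
    exact ⟨hC, fun W _ h ↦ h⟩
  | cons j J hj hJ ih =>
    have hsub : J ⊆ Finset.cons j J hj := Finset.subset_cons hj
    have hjm : j ∈ Finset.cons j J hj := Finset.mem_cons_self j J
    obtain ⟨h1, h2⟩ := ih (fun i hi ↦ hC i (hsub hi))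
      (fun i hi k hk ↦ hCC i (hsub hi) k (hsub hk))
      (fun K hK k hk ↦ hsep K (hK.trans hsub) k (hsub hk))
    have hs : G.ShortCycleSeparated G.cycleGenLength (G.outerBoundary (⋂ i ∈ J, C i))
        (G.outerBoundary (C j)) := by
      intro x c hc hcl
      refine (hsep J hsub j hjm hj x c hc hcl).imp_left fun h z hz hz' ↦ h z hz ?_
      simpa using outerBoundary_biInter_subset (↑J : Set ι) C hz'
    -- The second conclusion of the induction is carried along for this use, with `W = C j`.
    have hne : ((⋂ i ∈ J, C i) ∩ C j).Nonempty := by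
      rw [Set.inter_comm]
      exact h2 (C j) (hC j hjm) fun i hi ↦ hCC j hjm i (hsub hi)
    have heq : ⋂ i ∈ Finset.cons j J hj, C i = (⋂ i ∈ J, C i) ∩ C j := by
      ext z
      simp [and_comm]
    rw [heq]
    exact ⟨h1.inter (hC j hjm) hs hne, fun W hW hWC ↦
      inter_inter_nonempty h1 (hC j hjm) hs hne hW (h2 W hW fun i hi ↦ hWC i (hsub hi))
        (hWC j hjm)⟩

/-! ### The side of a set chosen by a bramble -/

/-- The component of `G - X` that contains all elements of the bramble `B` which avoid `X`. -/
def brambleSide (G : SimpleGraph V) (B : Set (Set V)) (X : Set V) : Set V :=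
  {v | ∃ b ∈ B, Disjoint X b ∧ ∃ u ∈ b, ∃ w : G.Walk u v, ∀ z ∈ w.support, z ∉ X}

section brambleSide

variable {B : Set (Set V)} {X Y : Set V}

lemma Covers.mono (h : Covers X B) (hXY : X ⊆ Y) : Covers Y B :=
  fun b hb ↦ (h b hb).mono (Set.inter_subset_inter_left b hXY)

lemma exists_disjoint_of_not_covers (h : ¬ Covers X B) : ∃ b ∈ B, Disjoint X b := by
  simpa [Covers, Set.not_nonempty_iff_eq_empty, Set.disjoint_iff_inter_eq_empty] using h

lemma brambleSide_anti (h : X ⊆ Y) : G.brambleSide B Y ⊆ G.brambleSide B X := by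
  rintro v ⟨b, hb, hd, u, hu, w, hw⟩
  exact ⟨b, hb, hd.mono_left h, u, hu, w, fun z hz hzX ↦ hw z hz (h hzX)⟩

lemma subset_brambleSide {b : Set V} (hb : b ∈ B) (hd : Disjoint X b) :
    b ⊆ G.brambleSide B X :=
  fun v hv ↦ ⟨b, hb, hd, v, hv, .nil, by simpa using Set.disjoint_right.1 hd hv⟩

lemma notMem_of_mem_brambleSide {v : V} (hv : v ∈ G.brambleSide B X) : v ∉ X := by
  obtain ⟨_, _, _, _, _, w, hw⟩ := hv
  exact hw v w.end_mem_support

lemma mem_brambleSide_of_walk {x y : V} (hx : x ∈ G.brambleSide B X) (w : G.Walk x y)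
    (hw : ∀ z ∈ w.support, z ∉ X) : y ∈ G.brambleSide B X := by
  obtain ⟨b, hb, hd, u, hu, w', hw'⟩ := hx
  refine ⟨b, hb, hd, u, hu, w'.append w, fun z hz ↦ ?_⟩
  rcases (Walk.mem_support_append_iff _ _).1 hz with hz | hz
  exacts [hw' z hz, hw z hz]

lemma mem_brambleSide_of_adj {x y : V} (hx : x ∈ G.brambleSide B X) (h : G.Adj x y)
    (hy : y ∉ X) : y ∈ G.brambleSide B X :=
  mem_brambleSide_of_walk hx (.cons h .nil) (by simp [notMem_of_mem_brambleSide hx, hy])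

lemma outerBoundary_brambleSide_subset : G.outerBoundary (G.brambleSide B X) ⊆ X := by
  rintro y ⟨hy, x, hx, h⟩
  by_contra hyX
  exact hy (mem_brambleSide_of_adj hx h hyX)

lemma IsBramble.isConnectedSet_brambleSide (hB : G.IsBramble B) (h : ¬ Covers X B) :
    G.IsConnectedSet (G.brambleSide B X) := by
  classical
  refine isConnectedSet_iff.2 ⟨?_, fun x hx y hy ↦ ?_⟩
  · obtain ⟨b, hb, hd⟩ := exists_disjoint_of_not_covers h
    exact (isConnectedSet_iff.1 (hB.connected b hb)).1.mono (subset_brambleSide hb hd)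
  · suffices ∃ w : G.Walk x y, ∀ z ∈ w.support, z ∉ X by
      obtain ⟨w, hw⟩ := this
      exact ⟨w, fun z hz ↦ mem_brambleSide_of_walk hx (w.takeUntil z hz)
        fun u hu ↦ hw u (w.support_takeUntil_subset_support hz hu)⟩
    obtain ⟨b, hb, hd, u, hu, w, hw⟩ := hx
    obtain ⟨b', hb', hd', u', hu', w', hw'⟩ := hy
    obtain ⟨p, hp⟩ := (isConnectedSet_iff.1 (hB.connected_union b hb b' hb')).2 u (.inl hu)
      u' (.inr hu')
    refine ⟨w.reverse.append (p.append w'), fun z hz ↦ ?_⟩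
    simp only [Walk.mem_support_append_iff, Walk.support_reverse, List.mem_reverse] at hz
    rcases hz with hz | hz | hz
    · exact hw z hz
    · rcases hp z hz with hz | hz
      exacts [Set.disjoint_right.1 hd hz, Set.disjoint_right.1 hd' hz]
    · exact hw' z hz

/-- Disjoint elements avoiding `X` and `Y` respectively are joined by an edge of their connected
union. As no edge joins `X` to `Y`, one of its ends lies in both sides. -/
lemma IsBramble.brambleSide_inter_nonempty (hB : G.IsBramble B) (hX : ¬ Covers X B)
    (hY : ¬ Covers Y B) (hXY : ∀ x ∈ X, ∀ y ∈ Y, ¬ G.Adj x y) :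
    (G.brambleSide B X ∩ G.brambleSide B Y).Nonempty := by
  obtain ⟨b, hb, hd⟩ := exists_disjoint_of_not_covers hX
  obtain ⟨b', hb', hd'⟩ := exists_disjoint_of_not_covers hY
  have hs := subset_brambleSide (G := G) hb hd
  have hs' := subset_brambleSide (G := G) hb' hd'
  obtain ⟨u, hu⟩ := (isConnectedSet_iff.1 (hB.connected b hb)).1
  obtain ⟨u', hu'⟩ := (isConnectedSet_iff.1 (hB.connected b' hb')).1
  by_cases hu'b : u' ∈ b
  · exact ⟨u', hs hu'b, hs' hu'⟩
  obtain ⟨p, hp⟩ := (isConnectedSet_iff.1 (hB.connected_union b hb b' hb')).2 u (.inl hu)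
    u' (.inr hu')
  obtain ⟨d, hdp, hd1, hd2⟩ := p.exists_boundary_dart b hu hu'b
  have hd2' : d.snd ∈ b' := (hp _ (p.dart_snd_mem_support_of_mem_darts hdp)).resolve_left hd2
  by_cases h2 : d.snd ∈ X
  · by_cases h1 : d.fst ∈ Y
    · exact absurd d.adj.symm (hXY _ h2 _ h1)
    · exact ⟨d.fst, hs hd1, mem_brambleSide_of_adj (hs' hd2') d.adj.symm h1⟩
  · exact ⟨d.snd, mem_brambleSide_of_adj (hs hd1) d.adj h2, hs' hd2'⟩

end brambleSide

/-! ### Near components and the core -/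

/-- The graph on `V` in which two vertices of `U` are adjacent if they are joined in `G` by a walk
of length at most `r`. -/
def nearGraph (G : SimpleGraph V) (r : ℕ) (U : Set V) : SimpleGraph V where
  Adj a b := a ≠ b ∧ a ∈ U ∧ b ∈ U ∧ ∃ w : G.Walk a b, w.length ≤ r
  symm := ⟨fun _ _ ⟨hne, ha, hb, w, hw⟩ ↦ ⟨hne.symm, hb, ha, w.reverse, by simpa using hw⟩⟩
  loopless := ⟨fun _ h ↦ h.1 rfl⟩

/-- The vertices of `U` that can be reached from `x` by jumps of length at most `r` within `U`. -/
def nearComponent (G : SimpleGraph V) (r : ℕ) (U : Set V) (x : V) : Set V :=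
  {y | y ∈ U ∧ (G.nearGraph r U).Reachable x y}

lemma nearComponent_mono {r : ℕ} {U U' : Set V} (h : U ⊆ U') (x : V) :
    G.nearComponent r U x ⊆ G.nearComponent r U' x := by
  have hle : G.nearGraph r U ≤ G.nearGraph r U' := fun _ _ hab ↦
    ⟨hab.1, h hab.2.1, h hab.2.2.1, hab.2.2.2⟩
  exact fun _ hy ↦ ⟨h hy.1, hy.2.mono hle⟩

lemma nearComponent_eq_of_walk {r : ℕ} {U : Set V} {x y a b : V}
    (ha : a ∈ G.nearComponent r U x) (hb : b ∈ G.nearComponent r U y) (w : G.Walk a b)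
    (hw : w.length ≤ r) : G.nearComponent r U x = G.nearComponent r U y := by
  have hab : (G.nearGraph r U).Reachable a b := by
    by_cases hne : a = b
    · rw [hne]
    · exact Adj.reachable ⟨hne, ha.1, hb.1, w, hw⟩
  have hxy := (ha.2.trans hab).trans hb.2.symm
  ext z
  exact and_congr_right fun _ ↦ ⟨hxy.symm.trans, hxy.trans⟩

lemma Walk.exists_walk_length_le_half {x a b : V} (c : G.Walk x x) {l : ℕ} (hc : c.length ≤ l)
    (ha : a ∈ c.support) (hb : b ∈ c.support) : ∃ w : G.Walk a b, w.length ≤ l / 2 := by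
  classical
  have hb' : b ∈ (c.rotate a ha).support := (c.mem_support_rotate_iff a ha).2 hb
  have hlen := congrArg length ((c.rotate a ha).take_spec hb')
  rw [length_append, length_rotate] at hlen
  by_cases h : ((c.rotate a ha).takeUntil b hb').length ≤ l / 2
  · exact ⟨_, h⟩
  · exact ⟨((c.rotate a ha).dropUntil b hb').reverse, by rw [length_reverse]; omega⟩

/-- The part of `G - U` to which the elements of `B` point, if no `r`-near component of `U`
covers `B`. -/
def brambleCore (G : SimpleGraph V) (B : Set (Set V)) (r : ℕ) (U : Set V) : Set V :=
  ⋂ x, G.brambleSide B (G.nearComponent r U x)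

/-- Indexing the core by all vertices makes the comparison termwise; a vertex outside `U` has an
empty near component. -/
lemma brambleCore_anti {B : Set (Set V)} {r : ℕ} {U U' : Set V} (h : U ⊆ U') :
    G.brambleCore B r U' ⊆ G.brambleCore B r U :=
  Set.iInter_mono fun x ↦ brambleSide_anti (nearComponent_mono h x)

lemma disjoint_brambleCore {B : Set (Set V)} {r : ℕ} {U : Set V} :
    Disjoint (G.brambleCore B r U) U :=
  Set.disjoint_left.2 fun v hv hvU ↦
    notMem_of_mem_brambleSide (Set.mem_iInter.1 hv v) ⟨hvU, .refl v⟩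

lemma IsBramble.isConnectedSet_brambleCore [Finite V] [Nonempty V] {B : Set (Set V)}
    (hB : G.IsBramble B) (hl : 2 ≤ G.cycleGenLength) {U : Set V}
    (hU : ∀ x, ¬ Covers (G.nearComponent (G.cycleGenLength / 2) U x) B) :
    G.IsConnectedSet (G.brambleCore B (G.cycleGenLength / 2) U) := by
  classical
  have := Fintype.ofFinite V
  set r := G.cycleGenLength / 2 with hr
  have hr1 : 1 ≤ r := by omega
  -- The components themselves serve as indices, so that distinct indices are never within distance
  -- `r` of each other. As `r ≥ 1`, they are not adjacent either.
  let I : Finset (Set V) := Finset.univ.image (G.nearComponent r U)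
  have hI : ∀ X ∈ I, ∃ x, G.nearComponent r U x = X := by simp [I]
  have heq : G.brambleCore B r U = ⋂ X ∈ I, G.brambleSide B X := by
    simp [I, brambleCore]
  rw [heq]
  refine (isConnectedSet_biInter I (Finset.univ_nonempty.image _) (G.brambleSide B) ?_ ?_ ?_).1
  · intro X hX
    obtain ⟨x, rfl⟩ := hI X hX
    exact hB.isConnectedSet_brambleSide (hU x)
  · intro X hX Y hY
    obtain ⟨x, rfl⟩ := hI X hX
    obtain ⟨y, rfl⟩ := hI Y hY
    by_cases hxy : G.nearComponent r U x = G.nearComponent r U y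
    · rw [hxy, Set.inter_self]
      exact (isConnectedSet_iff.1 (hB.isConnectedSet_brambleSide (hU y))).1
    · exact hB.brambleSide_inter_nonempty (hU x) (hU y) fun a ha b hb hab ↦
        hxy (nearComponent_eq_of_walk ha hb (.cons hab .nil) (by simpa using hr1))
  · intro J hJ Y hY hYJ x c hc hcl
    by_contra! hcon
    obtain ⟨⟨a, hac, ha⟩, b, hbc, hb⟩ := hcon
    obtain ⟨X, hX, ha⟩ := Set.mem_iUnion₂.1 ha
    obtain ⟨x, rfl⟩ := hI X (hJ hX)
    obtain ⟨y, rfl⟩ := hI Y hY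
    obtain ⟨w, hw⟩ := c.exists_walk_length_le_half hcl hac hbc
    refine hYJ ?_
    rwa [← nearComponent_eq_of_walk (outerBoundary_brambleSide_subset ha)
      (outerBoundary_brambleSide_subset hb) w hw]

/-- Each `r`-near component of a set of vertices extends to a connected set by adding fewer than
`r` vertices for each of its elements but one. -/
lemma exists_isConnectedSet_nearComponent_subset [Finite V] (r : ℕ) (U : Set V) (x : V)
    (hne : (G.nearComponent r U x).Nonempty) :
    ∃ Y, G.nearComponent r U x ⊆ Y ∧ G.IsConnectedSet Y ∧
      Y.ncard ≤ ((G.nearComponent r U x).ncard - 1) * r + 1 := by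
  classical
  set S := G.nearComponent r U x with hS
  obtain ⟨y, hy⟩ := hne
  have key : ∀ m, m + 1 ≤ S.ncard → ∃ S' ⊆ S, y ∈ S' ∧ S'.ncard = m + 1 ∧
      ∃ Y, S' ⊆ Y ∧ G.IsConnectedSet Y ∧ Y.ncard ≤ m * r + 1 := by
    intro m
    induction m with
    | zero =>
      intro _
      exact ⟨{y}, by simpa using hy, rfl, by simp, {y}, subset_rfl, isConnectedSet_singleton y,
        by simp⟩
    | succ m ih =>
      intro hm
      obtain ⟨S', hS'S, hyS', hcard, Y, hSY, hY, hYc⟩ := ih (by omega)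
      obtain ⟨z, hz, hzS'⟩ := Set.exists_mem_notMem_of_ncard_lt_ncard (s := S') (t := S) (by omega)
      obtain ⟨p⟩ := hy.2.symm.trans hz.2
      obtain ⟨d, -, hd1, hd2⟩ := p.exists_boundary_dart S' hyS' hzS'
      obtain ⟨-, -, hdU, w, hw⟩ := d.adj
      have hdS : d.snd ∈ S := ⟨hdU, (hS'S hd1).2.trans d.adj.reachable⟩
      refine ⟨insert d.snd S', Set.insert_subset hdS hS'S, .inr hyS',
        by rw [Set.ncard_insert_of_notMem hd2, hcard], Y ∪ {v | v ∈ w.support},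
        Set.insert_subset (.inr w.end_mem_support) (hSY.trans Set.subset_union_left), ?_, ?_⟩
      · exact induce_union_connected hY.preconnected w.connected_induce_support.preconnected
          ⟨d.fst, hSY hd1, w.start_mem_support⟩
      -- The first vertex of `w` is already in `Y`, so only the at most `r` others count.
      · have hsub : Y ∪ {v | v ∈ w.support} ⊆ Y ∪ (w.support.tail.toFinset : Set V) := by
          rintro v (hv | hv)
          · exact .inl hv
          · rw [Set.mem_ofPred_eq, Walk.mem_support_iff] at hv
            rcases hv with rfl | hv
            · exact .inl (hSY hd1)
            · exact .inr (by simpa using hv)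
        have htail : (w.support.tail.toFinset : Set V).ncard ≤ r := by
          rw [Set.ncard_coe_finset]
          refine (List.toFinset_card_le _).trans ?_
          simpa using hw
        calc (Y ∪ {v | v ∈ w.support}).ncard
            ≤ (Y ∪ (w.support.tail.toFinset : Set V)).ncard :=
              Set.ncard_le_ncard hsub (Set.toFinite _)
          _ ≤ Y.ncard + (w.support.tail.toFinset : Set V).ncard := Set.ncard_union_le _ _
          _ ≤ (m * r + 1) + r := add_le_add hYc htail
          _ = (m + 1) * r + 1 := by ring
  have hpos : 0 < S.ncard := (Set.ncard_pos (Set.toFinite _)).2 ⟨y, hy⟩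
  obtain ⟨S', hS'S, -, hcard, Y, hSY, hY, hYc⟩ := key (S.ncard - 1) (by omega)
  have : S' = S := Set.eq_of_subset_of_ncard_le hS'S (by omega) (Set.toFinite _)
  exact ⟨Y, this ▸ hSY, hY, hYc⟩

/-! ### Trees and tree-decompositions -/

lemma IsTree.exists_adj_reachable_deleteEdges {T : Type*} {H : SimpleGraph T} (hH : H.IsTree)
    {s t : T} (hst : s ≠ t) :
    ∃ t', H.Adj t t' ∧ (H.deleteEdges {s(t, t')}).Reachable t' s := by
  obtain ⟨p, hp⟩ := hH.connected.exists_isPath t s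
  cases p with
  | nil => exact absurd rfl hst
  | @cons _ t' _ h p =>
    refine ⟨t', h, reachable_deleteEdges_iff_exists_walk.2 ⟨p, fun he ↦ ?_⟩⟩
    exact ((Walk.cons_isPath_iff h p).1 hp).2 (p.fst_mem_support_of_mem_edges he)

/-- A map on the nodes of a finite tree that sends each node to a neighbour inverts some edge. -/
lemma IsTree.exists_apply_apply_eq {T : Type*} [Finite T] {H : SimpleGraph T} (hH : H.IsTree)
    (f : T → T) (hf : ∀ t, H.Adj t (f t)) : ∃ t, f (f t) = t := by
  classical
  have := Fintype.ofFinite T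
  have hcard := hH.card_edgeFinset
  -- A tree has fewer edges than nodes, so two nodes choose the same edge.
  obtain ⟨t, -, t', -, hne, he⟩ := Finset.exists_ne_map_eq_of_card_lt_of_maps_to
    (s := Finset.univ) (t := H.edgeFinset) (f := fun t ↦ s(t, f t))
    (by rw [Finset.card_univ]; omega) (fun t _ ↦ mem_edgeFinset.2 (hf t))
  rcases Sym2.eq_iff.1 he with ⟨h, -⟩ | ⟨h1, h2⟩
  · exact absurd h hne
  · exact ⟨t, by rw [h2, ← h1]⟩

namespace TreeDecomposition

variable {T : Type*} (D : G.TreeDecomposition T)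

/-- A vertex whose parts occur on both sides of the edge `tt'` lies in both of its parts, so a walk
avoiding their intersection never changes sides. -/
lemma reachable_deleteEdges {t t' : T} {u v : V} (w : G.Walk u v)
    (hw : ∀ z ∈ w.support, z ∉ D.part t ∩ D.part t') {s s' : T} (hs : u ∈ D.part s)
    (hs' : v ∈ D.part s') : (D.tree.deleteEdges {s(t, t')}).Reachable s s' := by
  induction w generalizing s with
  | @nil u =>
    obtain ⟨p, hp⟩ := D.isTree.connected.exists_isPath s s'
    refine reachable_deleteEdges_iff_exists_walk.2 ⟨p, fun he ↦ hw u (by simp) ⟨?_, ?_⟩⟩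
    · exact D.inter_subset_part s t s' p hp (p.fst_mem_support_of_mem_edges he) ⟨hs, hs'⟩
    · exact D.inter_subset_part s t' s' p hp (p.snd_mem_support_of_mem_edges he) ⟨hs, hs'⟩
  | @cons a b c hab w ih =>
    obtain ⟨s₁, ha, hb⟩ := D.exists_adj_mem_part a b hab
    refine Reachable.trans ?_ (ih (fun z hz ↦ hw z (by simp [hz])) hb hs')
    obtain ⟨p, hp⟩ := D.isTree.connected.exists_isPath s s₁
    refine reachable_deleteEdges_iff_exists_walk.2 ⟨p, fun he ↦ hw a (by simp) ⟨?_, ?_⟩⟩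
    · exact D.inter_subset_part s t s₁ p hp (p.fst_mem_support_of_mem_edges he) ⟨hs, ha⟩
    · exact D.inter_subset_part s t' s₁ p hp (p.snd_mem_support_of_mem_edges he) ⟨hs, ha⟩

/-- There is no haven-like map `β` that is defined on all subsets of the parts. -/
lemma exists_not_isConnectedSet [Finite T] (β : Set V → Set V)
    (hanti : ∀ U U', U ⊆ U' → β U' ⊆ β U) (hdisj : ∀ U, Disjoint (β U) U) :
    ∃ t, ∃ U ⊆ D.part t, ¬ G.IsConnectedSet (β U) := by
  by_contra! hconn
  have hstep : ∀ t, ∃ t' s v, D.tree.Adj t t' ∧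
      (D.tree.deleteEdges {s(t, t')}).Reachable t' s ∧ v ∈ β (D.part t) ∧ v ∈ D.part s := by
    intro t
    obtain ⟨v, hv⟩ := (isConnectedSet_iff.1 (hconn t _ subset_rfl)).1
    obtain ⟨s, hs⟩ := D.exists_mem_part v
    have hst : s ≠ t := by
      rintro rfl
      exact Set.disjoint_left.1 (hdisj _) hv hs
    obtain ⟨t', hadj, hr⟩ := D.isTree.exists_adj_reachable_deleteEdges hst
    exact ⟨t', s, v, hadj, hr, hv, hs⟩
  choose f s v hadj hr hv hs using hstep
  obtain ⟨t, ht⟩ := D.isTree.exists_apply_apply_eq f hadj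
  have hr' := hr (f t)
  rw [ht, Sym2.eq_swap] at hr'
  -- By antitonicity this connected set contains `v t` and `v (f t)`, which lie on opposite sides of
  -- the inverted edge.
  have hconn' := isConnectedSet_iff.1 (hconn t (D.part t ∩ D.part (f t)) Set.inter_subset_left)
  obtain ⟨w, hw⟩ := hconn'.2 (v t) (hanti _ _ Set.inter_subset_left (hv t))
    (v (f t)) (hanti _ _ Set.inter_subset_right (hv (f t)))
  have hmid := D.reachable_deleteEdges w
    (fun z hz ↦ Set.disjoint_left.1 (hdisj _) (hw z hz)) (hs t) (hs (f t))
  exact isAcyclic_iff_forall_adj_isBridge.1 D.isTree.isAcyclic (hadj t)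
    (((hr t).trans hmid).trans hr'.symm).symm

lemma ncard_part_le [Finite T] (t : T) : (D.part t).ncard ≤ D.width + 1 :=
  Nat.sub_le_iff_le_add.1
    (le_ciSup (f := fun t ↦ (D.part t).ncard - 1) (Set.finite_range _).bddAbove t)

end TreeDecomposition

/-- The decomposition into a single part shows that the infimum is attained. -/
lemma exists_treeDecomposition_width_eq (G : SimpleGraph V) :
    ∃ (T : Type) (_ : Finite T) (D : G.TreeDecomposition T), D.width = G.treeWidth :=
  Nat.sInf_mem (s := {k : ℕ | ∃ (T : Type) (_ : Finite T) (D : G.TreeDecomposition T),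
    D.width = k}) ⟨_, Unit, inferInstance,
      { tree := ⊥
        isTree := IsTree.of_subsingleton
        part := fun _ ↦ Set.univ
        exists_mem_part := fun _ ↦ ⟨(), trivial⟩
        exists_adj_mem_part := fun _ _ _ ↦ ⟨(), trivial, trivial⟩
        inter_subset_part := fun _ _ _ _ _ _ ↦ Set.subset_univ _ }, rfl⟩

lemma IsConnectedSet.connectedOrder_le {X : Set V} {B : Set (Set V)} (hX : G.IsConnectedSet X)
    (hXB : Covers X B) : G.connectedOrder B ≤ X.encard :=
  iInf₂_le X ⟨hX, hXB⟩

end SimpleGraph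

theorem mainTheorem3 {V : Type*} [Finite V] (G : SimpleGraph V)
    (hG : ∃ (x : V) (c : G.Walk x x), c.IsCycle)
    (B : Set (Set V)) (hB : G.IsBramble B) :
    G.connectedOrder B ≤ ((G.treeWidth * (G.cycleGenLength / 2) + 1 : ℕ) : ℕ∞) := by
  open SimpleGraph in
  have hl := three_le_cycleGenLength hG
  obtain ⟨x₀, -⟩ := hG
  have : Nonempty V := ⟨x₀⟩
  -- The empty bramble is covered even by an empty near component, which extends to no connected set
  -- by the growth argument.
  rcases B.eq_empty_or_nonempty with rfl | ⟨b, hb⟩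
  · refine ((isConnectedSet_singleton x₀).connectedOrder_le fun _ h ↦ h.elim).trans ?_
    rw [Set.encard_singleton]
    exact_mod_cast Nat.le_add_left 1 _
  obtain ⟨T, _, D, hD⟩ := G.exists_treeDecomposition_width_eq
  obtain ⟨t, U, hUt, hU⟩ := D.exists_not_isConnectedSet
    (G.brambleCore B (G.cycleGenLength / 2)) (fun _ _ ↦ brambleCore_anti)
    (fun _ ↦ disjoint_brambleCore)
  obtain ⟨x, hx⟩ : ∃ x, Covers (G.nearComponent (G.cycleGenLength / 2) U x) B := by
    by_contra! hcov
    exact hU (hB.isConnectedSet_brambleCore (by omega) hcov)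
  obtain ⟨Y, hsub, hY, hcard⟩ := exists_isConnectedSet_nearComponent_subset _ U x
    ((hx b hb).mono Set.inter_subset_left)
  refine (hY.connectedOrder_le (hx.mono hsub)).trans ?_
  rw [← Y.toFinite.cast_ncard_eq]
  have hle : (G.nearComponent (G.cycleGenLength / 2) U x).ncard ≤ G.treeWidth + 1 :=
    (Set.ncard_le_ncard (fun _ hy ↦ hUt hy.1) (Set.toFinite _)).trans
      (hD ▸ D.ncard_part_le t)
  exact_mod_cast hcard.trans (by gcongr; omega)
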